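/- Let $0<\gamma\le 2$, $\alpha=(4-3\gamma)/\sqrt6$ and $k\in\{0,-1\}$. Let $V\in C^2(\mathbb R)$ be such that $\{V<0\}$ is bounded and $V$ has finitely many critical points. A cosmology on a time interval consists of real functions $a>0$, $\phi$, $y=\dot\phi$, $\rho$ and $H=\dot a/a$ of $t$ with $$H^2+\frac{k}{a^2}=\frac13\Bigl(\rho+\frac12y^2+V(\phi)\Bigr),\qquad \dot H=-\frac12y^2-\frac\gamma2\rho+\frac{k}{a^2},$$ $$\dot y=-3Hy-V'(\phi)+\alpha\rho,\qquad \dot\rho=-3\gamma\rho H-\alpha\rho y .$$ Admissible initial states are the $(\phi_0,y_0,\rho_0,H_0)$ with $\rho_0\ge0$, $H_0>0$ which satisfy the first equation for some $a_0>0$. For $\ell\ge0$, neighbourhoods of the configuration at infinity $(\phi=+\infty,\,y=0,\,\rho=0,\,H=\sqrt{\ell/3})$ are the sets that contain $\{\phi>M,\ |y|<\delta,\ |\rho|<\delta,\ |H-\sqrt{\ell/3}|<\delta\}$ for some $M\in\mathbb R$, $\delta>0$. (i) If $V(\phi)\to\ell$ as $\phi\to+\infty$ with $V(\phi)>\ell$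 for all large $\phi$, then the configuration at infinity is asymptotically stable: for every neighbourhood $U$ of it there is a neighbourhood $U'$ such that the cosmologies with admissible initial state in $U'$ exist for all $t\ge0$ and remain in $U$; and there is a neighbourhood $U_0$ such that the cosmologies with admissible initial state in $U_0$ exist for all $t\ge0$ and satisfy $\phi\to+\infty$, $y\to0$, $\rho\to0$, $H\to\sqrt{\ell/3}$ as $t\to+\infty$. In particular this holds, with $\ell=0$, for $V(\phi)=V_0e^{-\lambda\phi}$ with $V_0,\lambda>0$. (ii) If $V(\phi)\to\ell$ as $\phi\to+\infty$ with $V(\phi)<\ell$ for all large $\phi$, then the configuration at infinity is unstable: there is a neighbourhood $U$ of it such that every neighbourhood of it contains an admissible initial state from which the cosmology leaves $U$ in finite time, and does not converge to the configuration at infinity as $t\to+\infty$. -/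

import Mathlib

open Filter Topology

/-- Standing assumption on the potential: `V` is of class `C²` on `ℝ`, the set where `V` is negative
is bounded, and `V` has finitely many critical points (both sets may be empty). -/
structure IsAdmissiblePotential (V : ℝ → ℝ) : Prop where
  contDiff : ContDiff ℝ 2 V
  bounded_neg : Bornology.IsBounded {x : ℝ | V x < 0}
  finite_crit : {x : ℝ | deriv V x = 0}.Finite

/-- The coupling constant `α = (4 - 3γ)/√6`. -/
noncomputable def coupling (γ : ℝ) : ℝ := (4 - 3 * γ) / √6

/-- The FRW cosmology of spatial curvature `k` with a scalar field `φ` (potential `V`) coupled to a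
barotropic fluid of density `ρ` and pressure `(γ - 1) ρ`, on the time interval `s`.
Here `a` is the scale factor, `H = a'/a` is the Hubble function and `y = φ'`.
The equations are the Friedmann constraint, the Raychaudhuri equation, the equation of motion of the
scalar field and the conservation equation; derivatives are taken within `s`
(so they are one-sided at an end point of `s`). -/
structure IsCosmology (V : ℝ → ℝ) (γ k : ℝ) (s : Set ℝ) (a φ y ρ H : ℝ → ℝ) : Prop where
  scale_pos : ∀ t ∈ s, 0 < a t
  hubble : ∀ t ∈ s, HasDerivWithinAt a (a t * H t) s t
  velocity : ∀ t ∈ s, HasDerivWithinAt φ (y t) s t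
  motion : ∀ t ∈ s, HasDerivWithinAt y
    (-3 * H t * y t - deriv V (φ t) + coupling γ * ρ t) s t
  conservation : ∀ t ∈ s, HasDerivWithinAt ρ
    (-3 * γ * ρ t * H t - coupling γ * ρ t * y t) s t
  raychaudhuri : ∀ t ∈ s, HasDerivWithinAt H
    (-(1 / 2) * y t ^ 2 - γ / 2 * ρ t + k / a t ^ 2) s t
  friedmann : ∀ t ∈ s,
    H t ^ 2 + k / a t ^ 2 = 1 / 3 * (ρ t + 1 / 2 * y t ^ 2 + V (φ t))

/-- The initial states `(φ, y, ρ, H)` of expanding cosmologies of curvature `k`: nonnegative fluid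
density, `H > 0`, and the Friedmann constraint for some value `a > 0` of the scale factor. -/
def expandingStates (V : ℝ → ℝ) (k : ℝ) : Set (ℝ × ℝ × ℝ × ℝ) :=
  {p | 0 ≤ p.2.2.1 ∧ 0 < p.2.2.2 ∧ ∃ a : ℝ, 0 < a ∧
    p.2.2.2 ^ 2 + k / a ^ 2 = 1 / 3 * (p.2.2.1 + 1 / 2 * p.2.1 ^ 2 + V p.1)}

/-- The filter of neighbourhoods of the configuration at infinity
`(φ = +∞, y = 0, ρ = 0, H = √(ℓ/3))`; it is generated by the sets
`φ > M, |y| < δ, |ρ| < δ, |H - √(ℓ/3)| < δ`. -/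
noncomputable def nhdsAtInfinity (ℓ : ℝ) : Filter (ℝ × ℝ × ℝ × ℝ) :=
  atTop ×ˢ 𝓝 0 ×ˢ 𝓝 0 ×ˢ 𝓝 √(ℓ / 3)

/-- The state `(φ, y, ρ, H)` equals `p` at time `0`. -/
def StartsAt (p : ℝ × ℝ × ℝ × ℝ) (φ y ρ H : ℝ → ℝ) : Prop :=
  (φ 0, y 0, ρ 0, H 0) = p

/-- `φ → +∞`, `y → 0`, `ρ → 0` and `H → √(ℓ/3)` as `t → +∞`. -/
def ConvergesToInfinity (ℓ : ℝ) (φ y ρ H : ℝ → ℝ) : Prop :=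
  Tendsto φ atTop atTop ∧ Tendsto y atTop (𝓝 0) ∧ Tendsto ρ atTop (𝓝 0) ∧
    Tendsto H atTop (𝓝 √(ℓ / 3))

/-- Some cosmology that exists for all times `t ≥ 0` starts at `p`. -/
def ExistsGlobally (V : ℝ → ℝ) (γ k : ℝ) (p : ℝ × ℝ × ℝ × ℝ) : Prop :=
  ∃ a φ y ρ H : ℝ → ℝ, IsCosmology V γ k (Set.Ici 0) a φ y ρ H ∧ StartsAt p φ y ρ H

/-- Lyapunov stability of the configuration at infinity for expanding cosmologies of curvature `k`:
given a neighbourhood `U` of it, the cosmologies that start sufficiently close to it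
exist for all times `t ≥ 0` and never leave `U`. -/
def IsStableAtInfinity (V : ℝ → ℝ) (γ k ℓ : ℝ) : Prop :=
  ∀ U ∈ nhdsAtInfinity ℓ, ∀ᶠ p in nhdsAtInfinity ℓ ⊓ 𝓟 (expandingStates V k),
    ExistsGlobally V γ k p ∧
    ∀ a φ y ρ H : ℝ → ℝ, IsCosmology V γ k (Set.Ici 0) a φ y ρ H → StartsAt p φ y ρ H →
      ∀ t, 0 ≤ t → (φ t, y t, ρ t, H t) ∈ U

/-- The configuration at infinity attracts the expanding cosmologies of curvature `k` that start
sufficiently close to it. -/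
def IsAttractiveAtInfinity (V : ℝ → ℝ) (γ k ℓ : ℝ) : Prop :=
  ∀ᶠ p in nhdsAtInfinity ℓ ⊓ 𝓟 (expandingStates V k),
    ExistsGlobally V γ k p ∧
    ∀ a φ y ρ H : ℝ → ℝ, IsCosmology V γ k (Set.Ici 0) a φ y ρ H → StartsAt p φ y ρ H →
      ConvergesToInfinity ℓ φ y ρ H

/-- Asymptotic stability: Lyapunov stability together with attractivity. -/
def IsAsymptoticallyStableAtInfinity (V : ℝ → ℝ) (γ k ℓ : ℝ) : Prop :=
  IsStableAtInfinity V γ k ℓ ∧ IsAttractiveAtInfinity V γ k ℓ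

/-- Instability of the configuration at infinity: there is a neighbourhood `U` of it such that,
arbitrarily close to it, there are initial states of expanding cosmologies of curvature `k` from
which the cosmology leaves `U` in finite time, and does not converge to the configuration either. -/
def IsUnstableAtInfinity (V : ℝ → ℝ) (γ k ℓ : ℝ) : Prop :=
  ∃ U ∈ nhdsAtInfinity ℓ, ∃ᶠ p in nhdsAtInfinity ℓ ⊓ 𝓟 (expandingStates V k),
    (∃ T : ℝ, 0 < T ∧ ∃ a φ y ρ H : ℝ → ℝ, IsCosmology V γ k (Set.Icc 0 T) a φ y ρ H ∧
      StartsAt p φ y ρ H ∧ (φ T, y T, ρ T, H T) ∉ U) ∧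
    ∀ a φ y ρ H : ℝ → ℝ, IsCosmology V γ k (Set.Ici 0) a φ y ρ H → StartsAt p φ y ρ H →
      ¬ ConvergesToInfinity ℓ φ y ρ H

/-! Everything rests on the energy `E = ρ + y²/2 + V(φ)`, which satisfies `E' = -3H(y² + γρ)`. The
sign of `ρ` is preserved, so `E` decreases while `H ≥ 0`; as `k ≤ 0`, `H` decreases and `E ≤ 3H²`.

Stability: finitely many critical points force `V` to decrease strictly to `ℓ` on some `[M, ∞)`. If
`E(0) < V(M)`, then `φ` cannot reach `M`, where `E ≥ V(M)`, and `H` cannot vanish, because `3H² ≥ E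
> ℓ ≥ 0` (`IsCosmology.trapped`). Then `ρ` and `y²/2` stay below `E(0) - ℓ`, which gives global
existence and Lyapunov stability.

Attraction amounts to `E → ℓ` (`IsCosmology.exists_energy_lt`). If `E ≥ ℓ + ε` forever, `H` has a
positive lower bound. For large `K` the function `y - K E` then grows at a uniform positive rate:
where `φ` is bounded the force `-V'` drives it, and where `φ` is large a fixed share of the energy
is kinetic or fluid, so dissipation drives it. But `y - K E` is bounded above.

Instability: a fluid-free state at rest at `φ = x` has energy `V(x) < ℓ`, so it cannot converge to a
configuration of energy `ℓ`. While it stays near the configuration, energy decay confines `φ` to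
`[M, x]`, where `V'` is bounded below by a positive constant; now `-y - K E` grows linearly, which
contradicts the bound on `y` in finite time (`exists_time_bound`). -/

/-! ### Existence, uniqueness and continuation for autonomous equations -/

section ODE

variable {E : Type*} [NormedAddCommGroup E] [NormedSpace ℝ E] [FiniteDimensional ℝ E]

/-- A continuous real function on `[0, T]` that starts below `c` and does not stay below `c` has a
first time at which it attains `c`. -/
theorem exists_first_hit {f : ℝ → ℝ} {c T : ℝ} (hf : ContinuousOn f (Set.Icc 0 T)) (h0 : f 0 < c)
    (h : ∃ t ∈ Set.Icc 0 T, c ≤ f t) :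
    ∃ S, 0 < S ∧ S ≤ T ∧ f S = c ∧ ∀ t, 0 ≤ t → t < S → f t < c := by
  have hK : IsCompact (Set.Icc 0 T ∩ f ⁻¹' Set.Ici c) :=
    isCompact_Icc.of_isClosed_subset (hf.preimage_isClosed_of_isClosed isClosed_Icc isClosed_Ici)
      Set.inter_subset_left
  obtain ⟨S, ⟨⟨hS0, hST⟩, hSc⟩, hmin⟩ := hK.exists_isLeast (by
    obtain ⟨t, ht, htc⟩ := h
    exact ⟨t, ht, htc⟩)
  obtain ⟨t, ht, htc⟩ := intermediate_value_Icc hS0 (hf.mono (Set.Icc_subset_Icc_right hST))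
    ⟨h0.le, hSc⟩
  have htS : t = S := le_antisymm ht.2 (hmin ⟨⟨ht.1, ht.2.trans hST⟩, htc.ge⟩)
  subst htS
  refine ⟨t, lt_of_le_of_ne hS0 ?_, hST, htc, fun s hs hst => ?_⟩
  · rintro rfl
    exact h0.ne htc
  · by_contra hcon
    exact absurd (hmin ⟨⟨hs, hst.le.trans hST⟩, not_lt.1 hcon⟩) (not_le.2 hst)

/-- A `C¹` vector field on a finite-dimensional space agrees on any ball with a vector field that is
bounded and globally Lipschitz. -/
theorem ContDiff.exists_lipschitzWith_bounded_eqOn_closedBall {F : E → E} (hF : ContDiff ℝ 1 F)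
    {R : ℝ} (hR : 0 < R) :
    ∃ (G : E → E) (K L : NNReal), LipschitzWith K G ∧ (∀ x, ‖G x‖ ≤ L) ∧
      ∀ x, ‖x‖ ≤ R → G x = F x := by
  let χ : ContDiffBump (0 : E) := ⟨R, R + 1, hR, by linarith⟩
  have hG : ContDiff ℝ 1 (fun x => χ x • F x) := χ.contDiff.smul hF
  have hc : HasCompactSupport (fun x => χ x • F x) := χ.hasCompactSupport.smul_right
  obtain ⟨K, hK⟩ := ContDiff.lipschitzWith_of_hasCompactSupport hc hG one_ne_zero
  obtain ⟨L, hL⟩ := hc.exists_bound_of_continuous hG.continuous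
  refine ⟨_, K, L.toNNReal, hK, fun x => (hL x).trans (Real.le_coe_toNNReal L), fun x hx => ?_⟩
  have : χ x = 1 := χ.one_of_mem_closedBall (by simpa using hx)
  simp [this]

/-- Solutions of a `C¹` autonomous equation exist on `[0, T]`, unless they reach the sphere of radius
`R` before. -/
theorem ContDiff.exists_solution_until_exit {F : E → E} (hF : ContDiff ℝ 1 F) {u₀ : E} {R T : ℝ}
    (hu₀ : ‖u₀‖ < R) (hT : 0 < T) :
    ∃ (S : ℝ) (u : ℝ → E), 0 < S ∧ S ≤ T ∧ u 0 = u₀ ∧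
      (∀ t ∈ Set.Icc 0 S, HasDerivWithinAt u (F (u t)) (Set.Icc 0 S) t) ∧ (S = T ∨ ‖u S‖ = R) := by
  obtain ⟨G, K, L, hK, hL, hGF⟩ :=
    hF.exists_lipschitzWith_bounded_eqOn_closedBall ((norm_nonneg _).trans_lt hu₀)
  -- The truncated field has speed at most `L`, so the radius `L T` is never left and
  -- Picard-Lindelöf covers all of `[0, T]` at once.
  have hP : IsPicardLindelof (fun _ => G) (⟨0, le_rfl, hT.le⟩ : Set.Icc 0 T) u₀
      (L * T.toNNReal) 0 L K :=
    IsPicardLindelof.of_time_independent (fun x _ => hL x) hK.lipschitzOnWith (by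
      simp [hT.le])
  obtain ⟨u, hu0, hu⟩ := hP.exists_eq_forall_mem_Icc_hasDerivWithinAt₀
  replace hu0 : u 0 = u₀ := hu0
  have hcont : ContinuousOn (fun t => ‖u t‖) (Set.Icc 0 T) :=
    (HasDerivWithinAt.continuousOn hu).norm
  by_cases h : ∃ t ∈ Set.Icc 0 T, R ≤ ‖u t‖
  · obtain ⟨S, hS, hST, hSR, hlt⟩ := exists_first_hit hcont (by simpa [hu0] using hu₀) h
    refine ⟨S, u, hS, hST, hu0, fun t ht => ?_, Or.inr hSR⟩
    rw [← hGF (u t)]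
    · exact (hu t ⟨ht.1, ht.2.trans hST⟩).mono (Set.Icc_subset_Icc_right hST)
    · rcases ht.2.lt_or_eq with h1 | rfl
      exacts [(hlt t ht.1 h1).le, hSR.le]
  · push Not at h
    refine ⟨T, u, hT, le_rfl, hu0, fun t ht => ?_, Or.inl rfl⟩
    rw [← hGF (u t) (h t ht).le]
    exact hu t ht

/-- Solutions of a `C¹` autonomous equation are unique. -/
theorem ContDiff.eqOn_of_solution {F : E → E} (hF : ContDiff ℝ 1 F) {u v : ℝ → E} {S : ℝ}
    (hu : ∀ t ∈ Set.Icc 0 S, HasDerivWithinAt u (F (u t)) (Set.Icc 0 S) t)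
    (hv : ∀ t ∈ Set.Icc 0 S, HasDerivWithinAt v (F (v t)) (Set.Icc 0 S) t) (h0 : u 0 = v 0) :
    Set.EqOn u v (Set.Icc 0 S) := by
  have huc := HasDerivWithinAt.continuousOn hu
  have hvc := HasDerivWithinAt.continuousOn hv
  obtain ⟨A, hA⟩ := isCompact_Icc.exists_bound_of_continuousOn huc
  obtain ⟨B, hB⟩ := isCompact_Icc.exists_bound_of_continuousOn hvc
  obtain ⟨G, K, L, hK, -, hGF⟩ := hF.exists_lipschitzWith_bounded_eqOn_closedBall
    (R := max (max A B) 1) (by positivity)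
  refine ODE_solution_unique (v := fun _ => G) (fun _ => hK) huc (fun t ht => ?_) hvc
    (fun t ht => ?_) h0
  · have ht' := Set.Ico_subset_Icc_self ht
    rw [hGF _ ((hA t ht').trans (by simp))]
    exact (hu t ht').mono_of_mem_nhdsWithin (Icc_mem_nhdsGE_of_mem ht)
  · have ht' := Set.Ico_subset_Icc_self ht
    rw [hGF _ ((hB t ht').trans (by simp))]
    exact (hv t ht').mono_of_mem_nhdsWithin (Icc_mem_nhdsGE_of_mem ht)

/-- A solution of a `C¹` autonomous equation that is bounded a priori on bounded time intervals
exists for all nonnegative times. -/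
theorem ContDiff.exists_solution_Ici {F : E → E} (hF : ContDiff ℝ 1 F) {u₀ : E}
    (hb : ∀ T, 0 < T → ∃ R, ∀ (S : ℝ) (u : ℝ → E), 0 < S → S ≤ T → u 0 = u₀ →
      (∀ t ∈ Set.Icc 0 S, HasDerivWithinAt u (F (u t)) (Set.Icc 0 S) t) → ‖u S‖ ≤ R) :
    ∃ u : ℝ → E, u 0 = u₀ ∧
      ∀ t ∈ Set.Ici (0 : ℝ), HasDerivWithinAt u (F (u t)) (Set.Ici 0) t := by
  have hex : ∀ n : ℕ, ∃ u : ℝ → E, u 0 = u₀ ∧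
      ∀ t ∈ Set.Icc (0 : ℝ) (n + 1), HasDerivWithinAt u (F (u t)) (Set.Icc 0 (n + 1)) t := by
    intro n
    obtain ⟨R, hR⟩ := hb (n + 1) (by positivity)
    obtain ⟨S, u, hS, hST, hu0, hu, h⟩ := hF.exists_solution_until_exit (u₀ := u₀)
      (R := max R ‖u₀‖ + 1) (T := n + 1) (by linarith [le_max_right R ‖u₀‖]) (by positivity)
    rcases h with rfl | h
    · exact ⟨u, hu0, hu⟩
    · have := hR S u hS hST hu0 hu
      linarith [le_max_left R ‖u₀‖]
  choose u hu0 hu using hex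
  have hglue : ∀ (n m : ℕ) (t : ℝ), 0 ≤ t → t ≤ n + 1 → t ≤ m + 1 → u n t = u m t := by
    intro n m t ht hn hm
    refine hF.eqOn_of_solution (S := t) (fun s hs => ?_) (fun s hs => ?_)
      ((hu0 n).trans (hu0 m).symm) ⟨ht, le_rfl⟩
    · exact (hu n s ⟨hs.1, hs.2.trans hn⟩).mono (Set.Icc_subset_Icc_right hn)
    · exact (hu m s ⟨hs.1, hs.2.trans hm⟩).mono (Set.Icc_subset_Icc_right hm)
  -- The solution `u n` lives on `[0, n + 1]`, not `[0, n]`: this leaves room to the right of `t`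
  -- even when `t` is an integer.
  refine ⟨fun t => u ⌈t⌉₊ t, by simp [hu0], fun t ht => ?_⟩
  have hlt : t < (⌈t⌉₊ : ℝ) + 1 := (Nat.le_ceil t).trans_lt (by linarith)
  have h1 : HasDerivWithinAt (u ⌈t⌉₊) (F (u ⌈t⌉₊ t)) (Set.Ici 0) t :=
    (hu ⌈t⌉₊ t ⟨ht, hlt.le⟩).mono_of_mem_nhdsWithin (by
      filter_upwards [self_mem_nhdsWithin, mem_nhdsWithin_of_mem_nhds (Iio_mem_nhds hlt)]
        with s hs hs' using ⟨hs, le_of_lt hs'⟩)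
  refine h1.congr_of_eventuallyEq ?_ rfl
  filter_upwards [self_mem_nhdsWithin, mem_nhdsWithin_of_mem_nhds (Iio_mem_nhds hlt)]
    with s hs hs'
  exact hglue _ _ s hs ((Nat.le_ceil s).trans (by linarith)) (le_of_lt hs')

end ODE

/-- A function on `[0, T]` whose derivative is at least `δ` grows by at least `δ T`. -/
theorem add_mul_le_of_le_derivWithin {f f' : ℝ → ℝ} {δ T : ℝ} (hT : 0 ≤ T)
    (hf : ∀ t ∈ Set.Icc 0 T, HasDerivWithinAt f (f' t) (Set.Icc 0 T) t)
    (hf' : ∀ t ∈ Set.Icc 0 T, δ ≤ f' t) : f 0 + δ * T ≤ f T := by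
  have hg : ∀ t ∈ Set.Icc 0 T,
      HasDerivWithinAt (fun t => f t - δ * t) (f' t - δ * 1) (Set.Icc 0 T) t :=
    fun t ht => (hf t ht).sub ((hasDerivWithinAt_id t _).const_mul δ)
  have hmono : MonotoneOn (fun t => f t - δ * t) (Set.Icc 0 T) :=
    monotoneOn_of_hasDerivWithinAt_nonneg (convex_Icc 0 T) (HasDerivWithinAt.continuousOn hg)
      (fun t ht => (hg t (interior_subset ht)).mono interior_subset)
      (fun t ht => by linarith [hf' t (interior_subset ht)])
  have h := hmono ⟨le_rfl, hT⟩ ⟨hT, le_rfl⟩ hT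
  simp only [mul_zero, sub_zero] at h
  linarith

/-- A function on `[0, ∞)` whose derivative is bounded below by a positive constant is unbounded. -/
theorem exists_lt_of_le_derivWithin {f f' : ℝ → ℝ} {δ : ℝ} (hδ : 0 < δ)
    (hf : ∀ t ∈ Set.Ici (0 : ℝ), HasDerivWithinAt f (f' t) (Set.Ici 0) t)
    (hf' : ∀ t, 0 ≤ t → δ ≤ f' t) (B : ℝ) : ∃ t, 0 ≤ t ∧ B < f t := by
  have h0 : (0 : ℝ) ≤ (|B - f 0| + 1) / δ := by positivity
  refine ⟨(|B - f 0| + 1) / δ, h0, ?_⟩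
  have h := add_mul_le_of_le_derivWithin h0
    (fun t ht => (hf t ht.1).mono Set.Icc_subset_Ici_self) (fun t ht => hf' t ht.1)
  have h2 : δ * ((|B - f 0| + 1) / δ) = |B - f 0| + 1 := by field_simp
  rw [h2] at h
  linarith [le_abs_self (B - f 0)]

/-! ### Energy, monotonicity and trapping -/

namespace IsCosmology

variable {V : ℝ → ℝ} {γ k : ℝ} {s : Set ℝ} {a φ y ρ H : ℝ → ℝ}

theorem mono (h : IsCosmology V γ k s a φ y ρ H) {s' : Set ℝ} (hs : s' ⊆ s) :
    IsCosmology V γ k s' a φ y ρ H where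
  scale_pos t ht := h.scale_pos t (hs ht)
  hubble t ht := (h.hubble t (hs ht)).mono hs
  velocity t ht := (h.velocity t (hs ht)).mono hs
  motion t ht := (h.motion t (hs ht)).mono hs
  conservation t ht := (h.conservation t (hs ht)).mono hs
  raychaudhuri t ht := (h.raychaudhuri t (hs ht)).mono hs
  friedmann t ht := h.friedmann t (hs ht)

/-- The energy balance `(ρ + y²/2 + V(φ))' = -3H(y² + γρ)`. -/
theorem hasDerivWithinAt_energy (h : IsCosmology V γ k s a φ y ρ H) (hV : Differentiable ℝ V)
    {t : ℝ} (ht : t ∈ s) :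
    HasDerivWithinAt (fun t => ρ t + 1 / 2 * y t ^ 2 + V (φ t))
      (-3 * H t * (y t ^ 2 + γ * ρ t)) s t := by
  have h1 := ((h.conservation t ht).add (((h.motion t ht).pow 2).const_mul (1 / 2))).add
    ((hV (φ t)).hasDerivAt.comp_hasDerivWithinAt t (h.velocity t ht))
  refine h1.congr_deriv ?_
  simp only [Nat.cast_ofNat, Nat.add_one_sub_one, pow_one]
  ring

/-- `ρ a^{3γ} e^{αφ}` is constant, hence the sign of the density is preserved. -/
theorem density_nonneg (h : IsCosmology V γ k s a φ y ρ H) (hs : Convex ℝ s) (h0 : (0 : ℝ) ∈ s)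
    (hρ : 0 ≤ ρ 0) {t : ℝ} (ht : t ∈ s) : 0 ≤ ρ t := by
  have hd : ∀ r ∈ s, HasDerivWithinAt
      (fun r => ρ r * Real.exp (3 * γ * Real.log (a r) + coupling γ * φ r)) 0 s r := by
    intro r hr
    have ha := (h.scale_pos r hr).ne'
    have h1 := (h.conservation r hr).mul (((((h.hubble r hr).log ha).const_mul (3 * γ)).add
      ((h.velocity r hr).const_mul (coupling γ))).exp)
    refine h1.congr_deriv ?_
    have : a r * H r / a r = H r := by field_simp
    simp only [this, Pi.add_apply]
    ring
  have hmono := monotoneOn_of_hasDerivWithinAt_nonneg hs (HasDerivWithinAt.continuousOn hd)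
    (fun r hr => (hd r (interior_subset hr)).mono interior_subset) (fun _ _ => le_rfl)
  have hanti := antitoneOn_of_hasDerivWithinAt_nonpos hs (HasDerivWithinAt.continuousOn hd)
    (fun r hr => (hd r (interior_subset hr)).mono interior_subset) (fun _ _ => le_rfl)
  have key : 0 ≤ ρ t * Real.exp (3 * γ * Real.log (a t) + coupling γ * φ t) := by
    rcases le_total 0 t with h' | h'
    · exact (mul_nonneg hρ (Real.exp_nonneg _)).trans (hmono h0 ht h')
    · exact (mul_nonneg hρ (Real.exp_nonneg _)).trans (hanti ht h0 h')
  exact nonneg_of_mul_nonneg_left key (Real.exp_pos _)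

theorem hubble_antitoneOn (h : IsCosmology V γ k s a φ y ρ H) (hs : Convex ℝ s) (h0 : (0 : ℝ) ∈ s)
    (hγ : 0 ≤ γ) (hk : k ≤ 0) (hρ : 0 ≤ ρ 0) : AntitoneOn H s := by
  refine antitoneOn_of_hasDerivWithinAt_nonpos hs (HasDerivWithinAt.continuousOn h.raychaudhuri)
    (fun r hr => (h.raychaudhuri r (interior_subset hr)).mono interior_subset) (fun r hr => ?_)
  have h1 := h.density_nonneg hs h0 hρ (interior_subset hr)
  have h2 : k / a r ^ 2 ≤ 0 := div_nonpos_of_nonpos_of_nonneg hk (sq_nonneg _)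
  nlinarith [sq_nonneg (y r), mul_nonneg hγ h1]

theorem energy_antitoneOn (h : IsCosmology V γ k s a φ y ρ H) (hV : Differentiable ℝ V)
    (hs : Convex ℝ s) (h0 : (0 : ℝ) ∈ s) (hγ : 0 ≤ γ) (hρ : 0 ≤ ρ 0) (hH : ∀ t ∈ s, 0 ≤ H t) :
    AntitoneOn (fun t => ρ t + 1 / 2 * y t ^ 2 + V (φ t)) s := by
  refine antitoneOn_of_hasDerivWithinAt_nonpos hs
    (HasDerivWithinAt.continuousOn fun r hr => h.hasDerivWithinAt_energy hV hr)
    (fun r hr => (h.hasDerivWithinAt_energy hV (interior_subset hr)).mono interior_subset)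
    (fun r hr => ?_)
  have h1 := h.density_nonneg hs h0 hρ (interior_subset hr)
  have h2 := mul_nonneg (hH r (interior_subset hr))
    (add_nonneg (sq_nonneg (y r)) (mul_nonneg hγ h1))
  linarith

/-- This turns a lower bound on the energy into a lower bound on the expansion rate. -/
theorem energy_le_three_mul_hubble_sq (h : IsCosmology V γ k s a φ y ρ H) (hk : k ≤ 0) {t : ℝ}
    (ht : t ∈ s) : ρ t + 1 / 2 * y t ^ 2 + V (φ t) ≤ 3 * H t ^ 2 := by
  have h1 := h.friedmann t ht
  have h2 : k / a t ^ 2 ≤ 0 := div_nonpos_of_nonpos_of_nonneg hk (sq_nonneg _)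
  linarith

/-- If `V` decreases to `ℓ ≥ 0` on `[M, ∞)`, the field of an expanding cosmology whose energy is
initially below `V(M)` cannot cross the value `M`, and the expansion goes on. -/
theorem trapped {T M ℓ : ℝ} (h : IsCosmology V γ k (Set.Icc 0 T) a φ y ρ H) (hT : 0 ≤ T)
    (hV : Differentiable ℝ V) (hγ : 0 ≤ γ) (hk : k ≤ 0) (hℓ : 0 ≤ ℓ)
    (hVℓ : ∀ x, M ≤ x → ℓ < V x) (hρ : 0 ≤ ρ 0) (hH : 0 < H 0) (hφ : M < φ 0)
    (hE : ρ 0 + 1 / 2 * y 0 ^ 2 + V (φ 0) < V M) :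
    M < φ T ∧ 0 < H T := by
  -- Positivity of `H` is proved conditionally on `φ ≥ M`, so that it can be used up to the first
  -- time `φ` reaches `M` without circularity.
  have hpos : ∀ S, 0 ≤ S → S ≤ T → (∀ t ∈ Set.Icc 0 S, M ≤ φ t) → ∀ t ∈ Set.Icc 0 S, 0 < H t := by
    intro S hS hST hM
    by_contra! hcon
    have h' := h.mono (Set.Icc_subset_Icc_right hST)
    have hc : ContinuousOn (fun t => -H t) (Set.Icc 0 S) :=
      (HasDerivWithinAt.continuousOn h'.raychaudhuri).neg
    obtain ⟨r, hr0, hrS, hr, -⟩ := exists_first_hit hc (neg_lt_zero.2 hH) (by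
      obtain ⟨t, ht, h1⟩ := hcon
      exact ⟨t, ht, by linarith⟩)
    have hr' : r ∈ Set.Icc 0 S := ⟨hr0.le, hrS⟩
    have h1 := h'.energy_le_three_mul_hubble_sq hk hr'
    have h2 := hVℓ _ (hM r hr')
    have h3 := h'.density_nonneg (convex_Icc 0 S) ⟨le_rfl, hS⟩ hρ hr'
    rw [neg_eq_zero] at hr
    rw [hr] at h1
    nlinarith [sq_nonneg (y r)]
  have hφT : ∀ t ∈ Set.Icc 0 T, M < φ t := by
    by_contra! hcon
    have hc : ContinuousOn (fun t => -φ t) (Set.Icc 0 T) :=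
      (HasDerivWithinAt.continuousOn h.velocity).neg
    obtain ⟨r, hr0, hrT, hr, hlt⟩ := exists_first_hit hc (neg_lt_neg hφ) (by
      obtain ⟨t, ht, h1⟩ := hcon
      exact ⟨t, ht, by linarith⟩)
    rw [neg_inj] at hr
    have h' := h.mono (Set.Icc_subset_Icc_right hrT)
    have h0r : (0 : ℝ) ∈ Set.Icc 0 r := ⟨le_rfl, hr0.le⟩
    have hrr : r ∈ Set.Icc 0 r := ⟨hr0.le, le_rfl⟩
    have hHr := hpos r hr0.le hrT (fun t ht => by
      rcases ht.2.lt_or_eq with h1 | rfl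
      exacts [(neg_lt_neg_iff.1 (hlt t ht.1 h1)).le, hr.ge])
    have h1 := h'.energy_antitoneOn hV (convex_Icc 0 r) h0r hγ hρ (fun t ht => (hHr t ht).le)
      h0r hrr hr0.le
    have h3 := h'.density_nonneg (convex_Icc 0 r) h0r hρ hrr
    simp only [hr] at h1
    nlinarith [sq_nonneg (y r)]
  exact ⟨hφT T ⟨hT, le_rfl⟩, hpos T hT le_rfl (fun t ht => (hφT t ht).le) T ⟨hT, le_rfl⟩⟩

/-- In the situation of `IsCosmology.trapped`, all quantities stay in the region fixed by the
initial energy. -/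
theorem trapped_bounds {T M ℓ : ℝ} (h : IsCosmology V γ k (Set.Icc 0 T) a φ y ρ H) (hT : 0 ≤ T)
    (hV : Differentiable ℝ V) (hγ : 0 ≤ γ) (hk : k ≤ 0) (hℓ : 0 ≤ ℓ)
    (hVℓ : ∀ x, M ≤ x → ℓ < V x) (hρ : 0 ≤ ρ 0) (hH : 0 < H 0) (hφ : M < φ 0)
    (hE : ρ 0 + 1 / 2 * y 0 ^ 2 + V (φ 0) < V M) :
    M < φ T ∧ √(ℓ / 3) ≤ H T ∧ H T ≤ H 0 ∧ 0 ≤ ρ T ∧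
      ρ T + 1 / 2 * y T ^ 2 + V (φ T) ≤ ρ 0 + 1 / 2 * y 0 ^ 2 + V (φ 0) := by
  have htr : ∀ t ∈ Set.Icc 0 T, M < φ t ∧ 0 < H t := fun t ht =>
    (h.mono (Set.Icc_subset_Icc_right ht.2)).trapped ht.1 hV hγ hk hℓ hVℓ hρ hH hφ hE
  have h0T : (0 : ℝ) ∈ Set.Icc 0 T := ⟨le_rfl, hT⟩
  have hTT : T ∈ Set.Icc 0 T := ⟨hT, le_rfl⟩
  have hρT := h.density_nonneg (convex_Icc 0 T) h0T hρ hTT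
  refine ⟨(htr T hTT).1, ?_, h.hubble_antitoneOn (convex_Icc 0 T) h0T hγ hk hρ h0T hTT hT, hρT,
    h.energy_antitoneOn hV (convex_Icc 0 T) h0T hγ hρ (fun t ht => (htr t ht).2.le) h0T hTT hT⟩
  refine Real.sqrt_le_iff.2 ⟨(htr T hTT).2.le, ?_⟩
  have h1 := h.energy_le_three_mul_hubble_sq hk hTT
  have h2 := hVℓ _ (htr T hTT).1.le
  nlinarith [sq_nonneg (y T)]

end IsCosmology

/-! ### The equations of motion as an autonomous system -/

theorem IsAdmissiblePotential.differentiable {V : ℝ → ℝ} (hV : IsAdmissiblePotential V) :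
    Differentiable ℝ V :=
  hV.contDiff.differentiable two_ne_zero

theorem IsAdmissiblePotential.contDiff_deriv {V : ℝ → ℝ} (hV : IsAdmissiblePotential V) :
    ContDiff ℝ 1 (deriv V) :=
  (contDiff_succ_iff_deriv (n := 1).1 (by simpa [one_add_one_eq_two] using hV.contDiff)).2.2

/-- The equations of motion as an autonomous equation for `(log a, φ, y, ρ, H)`. -/
noncomputable def cosmologyField (V : ℝ → ℝ) (γ k : ℝ) (u : ℝ × ℝ × ℝ × ℝ × ℝ) :
    ℝ × ℝ × ℝ × ℝ × ℝ :=
  (u.2.2.2.2, u.2.2.1,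
    -3 * u.2.2.2.2 * u.2.2.1 - deriv V u.2.1 + coupling γ * u.2.2.2.1,
    -3 * γ * u.2.2.2.1 * u.2.2.2.2 - coupling γ * u.2.2.2.1 * u.2.2.1,
    -(1 / 2) * u.2.2.1 ^ 2 - γ / 2 * u.2.2.2.1 + k * Real.exp (-2 * u.1))

/-- With `log a` as the variable the curvature term is `k exp(-2 log a)`, which has no singularity,
so the field is `C¹` on the whole space. -/
theorem contDiff_cosmologyField {V : ℝ → ℝ} (hV : ContDiff ℝ 1 (deriv V)) (γ k : ℝ) :
    ContDiff ℝ 1 (cosmologyField V γ k) := by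
  unfold cosmologyField
  fun_prop

/-- A solution of the equations of motion that satisfies the Friedmann constraint at time `0` is a
cosmology. -/
theorem isCosmology_of_solution {V : ℝ → ℝ} {γ k : ℝ} {s : Set ℝ} (hV : Differentiable ℝ V)
    (hs : Convex ℝ s) (h0 : (0 : ℝ) ∈ s) {u : ℝ → ℝ × ℝ × ℝ × ℝ × ℝ}
    (hu : ∀ t ∈ s, HasDerivWithinAt u (cosmologyField V γ k (u t)) s t)
    (hc : (u 0).2.2.2.2 ^ 2 + k / Real.exp (u 0).1 ^ 2 =
      1 / 3 * ((u 0).2.2.2.1 + 1 / 2 * (u 0).2.2.1 ^ 2 + V (u 0).2.1)) :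
    IsCosmology V γ k s (fun t => Real.exp (u t).1) (fun t => (u t).2.1) (fun t => (u t).2.2.1)
      (fun t => (u t).2.2.2.1) (fun t => (u t).2.2.2.2) := by
  have hexp : ∀ x : ℝ, k / Real.exp x ^ 2 = k * Real.exp (-2 * x) := by
    intro x
    rw [div_eq_mul_inv, ← Real.exp_nat_mul, ← Real.exp_neg]
    norm_num
  have d1 : ∀ t ∈ s, HasDerivWithinAt (fun t => (u t).1) (u t).2.2.2.2 s t :=
    fun t ht => (hu t ht).fst
  have d2 : ∀ t ∈ s, HasDerivWithinAt (fun t => (u t).2.1) (u t).2.2.1 s t :=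
    fun t ht => (hu t ht).snd.fst
  have d3 : ∀ t ∈ s, HasDerivWithinAt (fun t => (u t).2.2.1) (cosmologyField V γ k (u t)).2.2.1 s t :=
    fun t ht => (hu t ht).snd.snd.fst
  have d4 : ∀ t ∈ s, HasDerivWithinAt (fun t => (u t).2.2.2.1)
      (cosmologyField V γ k (u t)).2.2.2.1 s t := fun t ht => (hu t ht).snd.snd.snd.fst
  have d5 : ∀ t ∈ s, HasDerivWithinAt (fun t => (u t).2.2.2.2)
      (cosmologyField V γ k (u t)).2.2.2.2 s t := fun t ht => (hu t ht).snd.snd.snd.snd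
  -- The defect in the Friedmann constraint is a first integral of the other equations.
  have hd : ∀ t ∈ s, HasDerivWithinAt (fun t => (u t).2.2.2.2 ^ 2 + k * Real.exp (-2 * (u t).1) -
      1 / 3 * ((u t).2.2.2.1 + 1 / 2 * (u t).2.2.1 ^ 2 + V (u t).2.1)) 0 s t := by
    intro t ht
    have h1 := (((d5 t ht).pow 2).add ((((d1 t ht).const_mul (-2)).exp).const_mul k)).sub
      ((((d4 t ht).add (((d3 t ht).pow 2).const_mul (1 / 2))).add
      ((hV _).hasDerivAt.comp_hasDerivWithinAt t (d2 t ht))).const_mul (1 / 3))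
    refine h1.congr_deriv ?_
    simp only [cosmologyField, Nat.cast_ofNat, Nat.add_one_sub_one, pow_one]
    ring
  have hmono := monotoneOn_of_hasDerivWithinAt_nonneg hs (HasDerivWithinAt.continuousOn hd)
    (fun r hr => (hd r (interior_subset hr)).mono interior_subset) (fun _ _ => le_rfl)
  have hanti := antitoneOn_of_hasDerivWithinAt_nonpos hs (HasDerivWithinAt.continuousOn hd)
    (fun r hr => (hd r (interior_subset hr)).mono interior_subset) (fun _ _ => le_rfl)
  refine ⟨fun t _ => Real.exp_pos _, fun t ht => (d1 t ht).exp, d2, d3, d4, fun t ht => ?_,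
    fun t ht => ?_⟩
  · rw [hexp]
    exact d5 t ht
  · rw [hexp] at hc ⊢
    rcases le_total 0 t with h | h
    · have h1 := hmono h0 ht h
      have h2 := hanti h0 ht h
      simp only at h1 h2
      linarith
    · have h1 := hmono ht h0 h
      have h2 := hanti ht h0 h
      simp only at h1 h2
      linarith

section Existence

variable {V : ℝ → ℝ} {γ k a₀ : ℝ} {p : ℝ × ℝ × ℝ × ℝ}

/-- A cosmology exists for all times `t ≥ 0` if it is bounded a priori on bounded intervals. -/
theorem existsGlobally_of_bound (hV : IsAdmissiblePotential V) (ha₀ : 0 < a₀)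
    (hp : p.2.2.2 ^ 2 + k / a₀ ^ 2 = 1 / 3 * (p.2.2.1 + 1 / 2 * p.2.1 ^ 2 + V p.1))
    (hb : ∀ T, 0 < T → ∃ R, ∀ (S : ℝ) (a φ y ρ H : ℝ → ℝ), 0 < S → S ≤ T →
      IsCosmology V γ k (Set.Icc 0 S) a φ y ρ H → StartsAt p φ y ρ H → a 0 = a₀ →
      ‖(Real.log (a S), φ S, y S, ρ S, H S)‖ ≤ R) :
    ExistsGlobally V γ k p := by
  obtain ⟨u, hu0, hu⟩ := (contDiff_cosmologyField hV.contDiff_deriv γ k).exists_solution_Ici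
    (u₀ := (Real.log a₀, p)) (fun T hT => by
      obtain ⟨R, hR⟩ := hb T hT
      refine ⟨R, fun S u hS hST hu0 hu => ?_⟩
      have := hR S _ _ _ _ _ hS hST (isCosmology_of_solution hV.differentiable (convex_Icc 0 S)
        ⟨le_rfl, hS.le⟩ hu (by simpa [hu0, Real.exp_log ha₀] using hp)) (by simp [StartsAt, hu0])
        (by simp [hu0, Real.exp_log ha₀])
      simpa only [Real.log_exp] using this)
  exact ⟨_, _, _, _, _, isCosmology_of_solution hV.differentiable (convex_Ici 0)
    Set.self_mem_Ici hu (by simpa [hu0, Real.exp_log ha₀] using hp), by simp [StartsAt, hu0]⟩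

/-- A cosmology exists on `[0, T]` unless its norm reaches the value `R` before. -/
theorem exists_isCosmology_until_exit (γ : ℝ) (hV : IsAdmissiblePotential V) (ha₀ : 0 < a₀)
    (hp : p.2.2.2 ^ 2 + k / a₀ ^ 2 = 1 / 3 * (p.2.2.1 + 1 / 2 * p.2.1 ^ 2 + V p.1))
    {R T : ℝ} (hR : ‖(Real.log a₀, p)‖ < R) (hT : 0 < T) :
    ∃ (S : ℝ) (a φ y ρ H : ℝ → ℝ), 0 < S ∧ S ≤ T ∧ IsCosmology V γ k (Set.Icc 0 S) a φ y ρ H ∧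
      StartsAt p φ y ρ H ∧ a 0 = a₀ ∧
      (S = T ∨ ‖(Real.log (a S), φ S, y S, ρ S, H S)‖ = R) := by
  obtain ⟨S, u, hS, hST, hu0, hu, h⟩ :=
    (contDiff_cosmologyField hV.contDiff_deriv γ k).exists_solution_until_exit hR hT
  refine ⟨S, _, _, _, _, _, hS, hST, isCosmology_of_solution hV.differentiable (convex_Icc 0 S)
    ⟨le_rfl, hS.le⟩ hu (by simpa [hu0, Real.exp_log ha₀] using hp), by simp [StartsAt, hu0],
    by simp [hu0, Real.exp_log ha₀], ?_⟩
  simpa only [Real.log_exp] using h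

end Existence

/-- A function with derivative bounded by `C` on `[0, T]` moves by at most `C T`. -/
theorem abs_le_add_mul_of_abs_derivWithin_le {f f' : ℝ → ℝ} {C T : ℝ} (hT : 0 ≤ T)
    (hf : ∀ t ∈ Set.Icc 0 T, HasDerivWithinAt f (f' t) (Set.Icc 0 T) t)
    (hf' : ∀ t ∈ Set.Icc 0 T, |f' t| ≤ C) : |f T| ≤ |f 0| + C * T := by
  have h := (convex_Icc 0 T).norm_image_sub_le_of_norm_hasDerivWithin_le hf hf'
    (⟨le_rfl, hT⟩ : (0 : ℝ) ∈ Set.Icc 0 T) ⟨hT, le_rfl⟩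
  rw [Real.norm_eq_abs, sub_zero, Real.norm_eq_abs, abs_of_nonneg hT] at h
  linarith [abs_sub_abs_le_abs_sub (f T) (f 0)]

/-- The scale factor and the field are controlled by `H` and `y` on bounded intervals. -/
theorem IsCosmology.norm_le {V : ℝ → ℝ} {γ k T C : ℝ} {a φ y ρ H : ℝ → ℝ}
    (h : IsCosmology V γ k (Set.Icc 0 T) a φ y ρ H) (hT : 0 ≤ T)
    (hy : ∀ t ∈ Set.Icc 0 T, |y t| ≤ C) (hρ : |ρ T| ≤ C) (hH : ∀ t ∈ Set.Icc 0 T, |H t| ≤ C) :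
    ‖(Real.log (a T), φ T, y T, ρ T, H T)‖ ≤ |Real.log (a 0)| + |φ 0| + C * T + C := by
  have hTT : T ∈ Set.Icc 0 T := ⟨hT, le_rfl⟩
  have hC : 0 ≤ C := (abs_nonneg _).trans hρ
  have hCT : 0 ≤ C * T := mul_nonneg hC hT
  have h1 := abs_le_add_mul_of_abs_derivWithin_le hT h.velocity hy
  have h2 := abs_le_add_mul_of_abs_derivWithin_le (f := fun t => Real.log (a t)) hT
    (fun t ht => ((h.hubble t ht).log (h.scale_pos t ht).ne').congr_deriv
      (mul_div_cancel_left₀ _ (h.scale_pos t ht).ne')) hH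
  have h3 := abs_nonneg (Real.log (a 0))
  have h4 := abs_nonneg (φ 0)
  simp only [norm_prod_le_iff, Real.norm_eq_abs]
  exact ⟨by linarith, by linarith, by linarith [hy T hTT], by linarith, by linarith [hH T hTT]⟩

/-! ### Potentials and neighbourhoods near infinity -/

/-- The derivative of an admissible potential has a constant sign near `+∞`. -/
theorem IsAdmissiblePotential.exists_deriv_sign {V : ℝ → ℝ} (hV : IsAdmissiblePotential V) :
    ∃ M, (∀ x, M ≤ x → 0 < deriv V x) ∨ (∀ x, M ≤ x → deriv V x < 0) := by
  obtain ⟨M, hM⟩ := hV.finite_crit.bddAbove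
  have hne : ∀ x, M + 1 ≤ x → deriv V x ≠ 0 := fun x hx h0 => by
    have : x ≤ M := hM h0
    linarith
  have hc : ∀ A, ContinuousOn (deriv V) A := fun A => hV.contDiff_deriv.continuous.continuousOn
  refine ⟨M + 1, ?_⟩
  rcases (hne (M + 1) le_rfl).lt_or_gt with h | h
  · right
    intro x hx
    by_contra! hcon
    obtain ⟨z, hz, hz0⟩ := intermediate_value_Icc hx (hc _) ⟨h.le, hcon⟩
    exact hne z hz.1 hz0
  · left
    intro x hx
    by_contra! hcon
    obtain ⟨z, hz, hz0⟩ := intermediate_value_Icc' hx (hc _) ⟨hcon, h.le⟩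
    exact hne z hz.1 hz0

theorem strictMonoOn_Ici_of_deriv_pos {V : ℝ → ℝ} (hV : Differentiable ℝ V) {M : ℝ}
    (h : ∀ x, M ≤ x → 0 < deriv V x) : StrictMonoOn V (Set.Ici M) :=
  strictMonoOn_of_deriv_pos (convex_Ici M) hV.continuous.continuousOn
    fun x hx => h x (interior_subset hx)

theorem strictAntiOn_Ici_of_deriv_neg {V : ℝ → ℝ} (hV : Differentiable ℝ V) {M : ℝ}
    (h : ∀ x, M ≤ x → deriv V x < 0) : StrictAntiOn V (Set.Ici M) :=
  strictAntiOn_of_deriv_neg (convex_Ici M) hV.continuous.continuousOn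
    fun x hx => h x (interior_subset hx)

/-- An eventually increasing `V` would stay below its limit, so the constant sign of `V'` must be
negative. -/
theorem IsAdmissiblePotential.exists_deriv_neg {V : ℝ → ℝ} {ℓ : ℝ} (hV : IsAdmissiblePotential V)
    (hVℓ : Tendsto V atTop (𝓝[>] ℓ)) : ∃ M, ∀ x, M ≤ x → ℓ < V x ∧ deriv V x < 0 := by
  have hlim := hVℓ.mono_right nhdsWithin_le_nhds
  obtain ⟨M₁, hM₁⟩ := eventually_atTop.1 (hVℓ.eventually self_mem_nhdsWithin)
  obtain ⟨M₂, h | h⟩ := hV.exists_deriv_sign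
  · have hmono := strictMonoOn_Ici_of_deriv_pos hV.differentiable h
    have h1 : ℓ < V (max M₁ M₂) := hM₁ _ (le_max_left _ _)
    have h2 : V (max M₁ M₂) ≤ ℓ := ge_of_tendsto hlim (by
      filter_upwards [eventually_ge_atTop (max M₁ M₂)] with x hx
      exact hmono.monotoneOn (le_max_right _ _ : M₂ ≤ _) ((le_max_right _ _).trans hx : M₂ ≤ x) hx)
    linarith
  · exact ⟨max M₁ M₂, fun x hx => ⟨hM₁ x ((le_max_left _ _).trans hx),
      h x ((le_max_right _ _).trans hx)⟩⟩

theorem IsAdmissiblePotential.exists_deriv_pos {V : ℝ → ℝ} {ℓ : ℝ} (hV : IsAdmissiblePotential V)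
    (hVℓ : Tendsto V atTop (𝓝[<] ℓ)) : ∃ M, ∀ x, M ≤ x → V x < ℓ ∧ 0 < deriv V x := by
  have hlim := hVℓ.mono_right nhdsWithin_le_nhds
  obtain ⟨M₁, hM₁⟩ := eventually_atTop.1 (hVℓ.eventually self_mem_nhdsWithin)
  obtain ⟨M₂, h | h⟩ := hV.exists_deriv_sign
  · exact ⟨max M₁ M₂, fun x hx => ⟨hM₁ x ((le_max_left _ _).trans hx),
      h x ((le_max_right _ _).trans hx)⟩⟩
  · have hmono := strictAntiOn_Ici_of_deriv_neg hV.differentiable h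
    have h1 : V (max M₁ M₂) < ℓ := hM₁ _ (le_max_left _ _)
    have h2 : ℓ ≤ V (max M₁ M₂) := le_of_tendsto hlim (by
      filter_upwards [eventually_ge_atTop (max M₁ M₂)] with x hx
      exact hmono.antitoneOn (le_max_right _ _ : M₂ ≤ _) ((le_max_right _ _).trans hx : M₂ ≤ x) hx)
    linarith

theorem mem_nhdsAtInfinity_iff {ℓ : ℝ} {U : Set (ℝ × ℝ × ℝ × ℝ)} :
    U ∈ nhdsAtInfinity ℓ ↔ ∃ M δ : ℝ, 0 < δ ∧ ∀ φ y ρ H : ℝ, M < φ → |y| < δ → |ρ| < δ →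
      |H - √(ℓ / 3)| < δ → (φ, y, ρ, H) ∈ U := by
  have hb := (atTop_basis_Ioi (α := ℝ)).prod ((Metric.nhds_basis_ball (x := (0 : ℝ))).prod
    ((Metric.nhds_basis_ball (x := (0 : ℝ))).prod (Metric.nhds_basis_ball (x := √(ℓ / 3)))))
  rw [nhdsAtInfinity, hb.mem_iff]
  constructor
  · rintro ⟨⟨M, δ₁, δ₂, δ₃⟩, ⟨-, h1, h2, h3⟩, hU⟩
    refine ⟨M, min δ₁ (min δ₂ δ₃), by positivity, fun φ y ρ H hφ hy hρ hH => hU ⟨hφ, ?_, ?_, ?_⟩⟩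
    · simpa using (lt_min_iff.1 hy).1
    · simpa using (lt_min_iff.1 (lt_min_iff.1 hρ).2).1
    · simpa [Real.dist_eq] using (lt_min_iff.1 (lt_min_iff.1 hH).2).2
  · rintro ⟨M, δ, hδ, h⟩
    refine ⟨⟨M, δ, δ, δ⟩, ⟨trivial, hδ, hδ, hδ⟩, ?_⟩
    rintro ⟨φ, y, ρ, H⟩ ⟨hφ, hy, hρ, hH⟩
    exact h φ y ρ H hφ (by simpa using hy) (by simpa using hρ) (by simpa [Real.dist_eq] using hH)

theorem tendsto_energy_nhdsAtInfinity {V : ℝ → ℝ} {ℓ : ℝ} (hV : Tendsto V atTop (𝓝 ℓ)) :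
    Tendsto (fun p : ℝ × ℝ × ℝ × ℝ => p.2.2.1 + 1 / 2 * p.2.1 ^ 2 + V p.1) (nhdsAtInfinity ℓ)
      (𝓝 ℓ) := by
  have h1 : Tendsto (fun p : ℝ × ℝ × ℝ × ℝ => p.1) (nhdsAtInfinity ℓ) atTop := tendsto_fst
  have h2 : Tendsto (fun p : ℝ × ℝ × ℝ × ℝ => p.2.1) (nhdsAtInfinity ℓ) (𝓝 0) :=
    tendsto_fst.comp tendsto_snd
  have h3 : Tendsto (fun p : ℝ × ℝ × ℝ × ℝ => p.2.2.1) (nhdsAtInfinity ℓ) (𝓝 0) :=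
    tendsto_fst.comp (tendsto_snd.comp tendsto_snd)
  have h := (h3.add ((h2.pow 2).const_mul (1 / 2))).add (hV.comp h1)
  rwa [show (0 : ℝ) + 1 / 2 * 0 ^ 2 + ℓ = ℓ by ring] at h

/-- The friction and coupling terms of the scalar field equation are controlled by a small constant
and the dissipation rate of the energy. -/
theorem abs_friction_le {α γ c h y ρ H : ℝ} (hγ : 0 < γ) (hc : 0 < c) (hρ : 0 ≤ ρ) (hH : |H| ≤ h) :
    |(-3 * H * y + α * ρ)| ≤ c / 2 + (9 * h ^ 2 / (2 * c) + |α| / γ) * (y ^ 2 + γ * ρ) := by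
  have h0 : 0 ≤ h := (abs_nonneg H).trans hH
  have h1 : |(-3 * H * y + α * ρ)| ≤ 3 * h * |y| + |α| * ρ := by
    refine (abs_add_le _ _).trans ?_
    rw [abs_mul, abs_mul, abs_mul, abs_of_nonneg hρ]
    norm_num
    gcongr
  have h2 : 3 * h * |y| ≤ c / 2 + 9 * h ^ 2 / (2 * c) * y ^ 2 := by
    -- Young's inequality, with the weights chosen so that the constant term is `c / 2`.
    have : c / 2 + 9 * h ^ 2 / (2 * c) * y ^ 2 - 3 * h * |y| = (c - 3 * h * |y|) ^ 2 / (2 * c) := by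
      field_simp
      rw [← sq_abs y]
      ring
    have h3 : 0 ≤ (c - 3 * h * |y|) ^ 2 / (2 * c) := by positivity
    linarith
  have h4 : |α| * ρ = |α| / γ * (γ * ρ) := by field_simp
  have h5 : 0 ≤ 9 * h ^ 2 / (2 * c) * (γ * ρ) := by positivity
  have h6 : 0 ≤ |α| / γ * y ^ 2 := by positivity
  linarith

/-! ### Stability and attraction -/

section Stability

variable {V : ℝ → ℝ} {γ k ℓ M : ℝ}

/-- Trapping bounds `y`, `ρ`, `H` uniformly in time, hence `φ` and `log a` grow at most linearly and
blow-up is excluded. -/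
theorem existsGlobally_of_trapped (hV : IsAdmissiblePotential V) (hγ : 0 < γ) (hk : k ≤ 0)
    (hℓ : 0 ≤ ℓ) (hVℓ : ∀ x, M ≤ x → ℓ < V x) {p : ℝ × ℝ × ℝ × ℝ} (hp : p ∈ expandingStates V k)
    (hM : M < p.1) (hE : p.2.2.1 + 1 / 2 * p.2.1 ^ 2 + V p.1 < V M) : ExistsGlobally V γ k p := by
  obtain ⟨hρ, hH, a₀, ha₀, hF⟩ := hp
  refine existsGlobally_of_bound hV ha₀ hF fun T hT => ?_
  -- Trapping gives `y² < 2 V(M) ≤ (V(M) + 1)²`, `ρ < V(M)` and `H ≤ H(0)`; this constant dominates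
  -- all three.
  set C := V M + 1 + p.2.2.2 with hC
  refine ⟨|Real.log a₀| + |p.1| + C * T + C, fun S a φ y ρ H hS hST h hp ha => ?_⟩
  obtain ⟨rfl⟩ := hp
  simp only at hρ hH hM hE hC
  have hVM : 0 < V M := hℓ.trans_lt (hVℓ M le_rfl)
  have hb : ∀ t ∈ Set.Icc 0 S, |y t| ≤ C ∧ |ρ t| ≤ C ∧ |H t| ≤ C := by
    intro t ht
    obtain ⟨h1, h2, h3, h4, h5⟩ := (h.mono (Set.Icc_subset_Icc_right ht.2)).trapped_bounds ht.1
      hV.differentiable hγ.le hk hℓ hVℓ hρ hH hM hE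
    have h6 := hVℓ _ h1.le
    have h7 := Real.sqrt_nonneg (ℓ / 3)
    refine ⟨abs_le_of_sq_le_sq ?_ (by linarith), ?_, ?_⟩
    · have h8 : y t ^ 2 ≤ (V M + 1) ^ 2 := by nlinarith
      exact h8.trans (pow_le_pow_left₀ (by linarith) (by linarith) 2)
    · rw [abs_of_nonneg h4]
      nlinarith [sq_nonneg (y t)]
    · rw [abs_of_nonneg (h7.trans h2)]
      linarith
  have h1 := h.norm_le hS.le (fun t ht => (hb t ht).1) (hb S ⟨hS.le, le_rfl⟩).2.1
    (fun t ht => (hb t ht).2.2)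
  rw [ha] at h1
  have h2 : C * S ≤ C * T := mul_le_mul_of_nonneg_left hST (by linarith)
  linarith

/-- Were the curvature term at most `-ε` forever, `H' ≤ -ε` would make `H` negative. Once it is
small it remains so, because `a` is nondecreasing. -/
theorem IsCosmology.curvature_tendsto {a φ y ρ H : ℝ → ℝ}
    (h : IsCosmology V γ k (Set.Ici 0) a φ y ρ H) (hγ : 0 ≤ γ) (hk : k ≤ 0) (hρ : 0 ≤ ρ 0)
    (hH : ∀ t, 0 ≤ t → 0 ≤ H t) {ε : ℝ} (hε : 0 < ε) :
    ∀ᶠ t in atTop, -ε < k / a t ^ 2 := by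
  obtain ⟨r, hr0, hr⟩ : ∃ r, 0 ≤ r ∧ -ε < k / a r ^ 2 := by
    by_contra! hcon
    obtain ⟨t, ht, h1⟩ := exists_lt_of_le_derivWithin hε
      (fun t ht => (h.raychaudhuri t ht).neg) (fun t ht => by
        have h1 := h.density_nonneg (convex_Ici 0) Set.self_mem_Ici hρ ht
        nlinarith [hcon t ht, sq_nonneg (y t), mul_nonneg hγ h1]) 0
    have : 0 < -H t := h1
    linarith [hH t ht]
  have hmono : MonotoneOn a (Set.Ici 0) :=
    monotoneOn_of_hasDerivWithinAt_nonneg (convex_Ici 0) (HasDerivWithinAt.continuousOn h.hubble)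
      (fun t ht => (h.hubble t (interior_subset ht)).mono interior_subset)
      (fun t ht => mul_nonneg (h.scale_pos t (interior_subset ht)).le (hH t (interior_subset ht)))
  filter_upwards [eventually_ge_atTop r] with t ht
  have ht0 : (0 : ℝ) ≤ t := hr0.trans ht
  have h1 : a r ^ 2 ≤ a t ^ 2 := pow_le_pow_left₀ (h.scale_pos r hr0).le (hmono hr0 ht0 ht) 2
  have h2 : -k / a t ^ 2 ≤ -k / a r ^ 2 :=
    div_le_div_of_nonneg_left (by linarith) (pow_pos (h.scale_pos r hr0) 2) h1
  rw [neg_div, neg_div] at h2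
  linarith

/-- The energy of a trapped cosmology decays to the limit `ℓ` of the potential. -/
theorem IsCosmology.exists_energy_lt {a φ y ρ H : ℝ → ℝ}
    (h : IsCosmology V γ k (Set.Ici 0) a φ y ρ H) (hV : IsAdmissiblePotential V)
    (hlim : Tendsto V atTop (𝓝 ℓ)) (hγ : 0 < γ) (hγ₂ : γ ≤ 2) (hk : k ≤ 0) (hℓ : 0 ≤ ℓ)
    (hVℓ : ∀ x, M ≤ x → ℓ < V x ∧ deriv V x < 0) (hφ : ∀ t, 0 ≤ t → M < φ t)
    (hρ : ∀ t, 0 ≤ t → 0 ≤ ρ t) (hH : ∀ t, 0 ≤ t → 0 ≤ H t) {h₁ E₁ : ℝ}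
    (hH' : ∀ t, 0 ≤ t → H t ≤ h₁)
    (hE : ∀ t, 0 ≤ t → ρ t + 1 / 2 * y t ^ 2 + V (φ t) ≤ E₁) {ε : ℝ} (hε : 0 < ε) :
    ∃ t, 0 ≤ t ∧ ρ t + 1 / 2 * y t ^ 2 + V (φ t) < ℓ + ε := by
  by_contra! hcon
  obtain ⟨h₀, hh₀, hHh₀⟩ : ∃ h₀, 0 < h₀ ∧ ∀ t, 0 ≤ t → h₀ ≤ H t := by
    refine ⟨√(ε / 3), by positivity, fun t ht => Real.sqrt_le_iff.2 ⟨hH t ht, ?_⟩⟩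
    linarith [h.energy_le_three_mul_hubble_sq hk ht, hcon t ht]
  -- Beyond `M'` the potential accounts for less than `ℓ + ε/2`, so at least `ε/2` of the energy is
  -- kinetic or fluid. Up to `M'` compactness gives a uniform slope `-c`.
  obtain ⟨M', hM'⟩ := eventually_atTop.1
    (hlim.eventually (gt_mem_nhds (show ℓ < ℓ + ε / 2 by linarith)))
  obtain ⟨c, hc, hcV⟩ : ∃ c, 0 < c ∧ ∀ x, M ≤ x → x ≤ M' → deriv V x ≤ -c := by
    obtain ⟨x₀, hx₀, hmax⟩ := isCompact_Icc.exists_isMaxOn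
      (Set.nonempty_Icc.2 (le_max_left M M')) hV.contDiff_deriv.continuous.continuousOn
    exact ⟨-deriv V x₀, neg_pos.2 (hVℓ x₀ hx₀.1).2, fun x hx hx' => by
      rw [neg_neg]
      exact hmax ⟨hx, hx'.trans (le_max_right _ _)⟩⟩
  set A := 9 * h₁ ^ 2 / (2 * c) + |coupling γ| / γ with hA
  have hA0 : 0 ≤ A := by positivity
  -- In `3 K h₀ = A + 2c/(γε)` the first term absorbs friction and coupling; the second makes
  -- dissipation worth at least `c` beyond `M'`.
  set K := (A + 2 * c / (γ * ε)) / (3 * h₀) with hK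
  have hK0 : 0 ≤ K := by positivity
  have hKh : 3 * K * h₀ = A + 2 * c / (γ * ε) := by rw [hK]; field_simp
  obtain ⟨t, ht, h1⟩ := exists_lt_of_le_derivWithin (half_pos hc)
    (fun t ht => (h.motion t ht).sub ((h.hasDerivWithinAt_energy hV.differentiable ht).const_mul K))
    (fun t ht => by
      have hρt := hρ t ht
      have hD : 0 ≤ y t ^ 2 + γ * ρ t := by positivity
      have h1 : |(-3 * H t * y t + coupling γ * ρ t)| ≤ c / 2 + A * (y t ^ 2 + γ * ρ t) :=
        abs_friction_le hγ hc hρt (by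
          rw [abs_of_nonneg (hH t ht)]
          exact hH' t ht)
      have h2 := neg_le_of_abs_le h1
      have h3 : (3 * K * h₀) * (y t ^ 2 + γ * ρ t) ≤ 3 * K * H t * (y t ^ 2 + γ * ρ t) := by
        gcongr
        exact hHh₀ t ht
      rw [hKh] at h3
      have h4 : 0 ≤ 2 * c / (γ * ε) * (y t ^ 2 + γ * ρ t) := by positivity
      rcases le_or_gt (φ t) M' with h5 | h5
      · linarith [hcV _ (hφ t ht).le h5]
      · have h6 := hM' _ h5.le
        have h7 := hcon t ht
        -- Since `γ ≤ 2`, `y² + γρ ≥ γ(y²/2 + ρ)`.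
        have h8 : γ * ε / 2 ≤ y t ^ 2 + γ * ρ t := by nlinarith [sq_nonneg (y t)]
        have h9 : 2 * c / (γ * ε) * (γ * ε / 2) ≤ 2 * c / (γ * ε) * (y t ^ 2 + γ * ρ t) := by
          gcongr
        have h10 : 2 * c / (γ * ε) * (γ * ε / 2) = c := by field_simp
        linarith [(hVℓ _ (hφ t ht).le).2]) (1 + E₁)
  have h2 := hE t ht
  have h3 := hcon t ht
  have h4 := hρ t ht
  have h5 := (hVℓ _ (hφ t ht).le).1
  have h6 : 0 ≤ K * (ρ t + 1 / 2 * y t ^ 2 + V (φ t)) := mul_nonneg hK0 (by linarith)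
  simp only [Pi.sub_apply] at h1
  -- The upper bound `y ≤ (y² + 1)/2 ≤ E₁ + 1/2` contradicts `y > 1 + E₁`.
  nlinarith [sq_nonneg (y t - 1)]

/-- A trapped cosmology converges to the configuration at infinity. -/
theorem IsCosmology.convergesToInfinity {a φ y ρ H : ℝ → ℝ}
    (h : IsCosmology V γ k (Set.Ici 0) a φ y ρ H) (hV : IsAdmissiblePotential V)
    (hlim : Tendsto V atTop (𝓝 ℓ)) (hγ : 0 < γ) (hγ₂ : γ ≤ 2) (hk : k ≤ 0) (hℓ : 0 ≤ ℓ)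
    (hVℓ : ∀ x, M ≤ x → ℓ < V x ∧ deriv V x < 0) (hρ : 0 ≤ ρ 0) (hH : 0 < H 0) (hφ : M < φ 0)
    (hE : ρ 0 + 1 / 2 * y 0 ^ 2 + V (φ 0) < V M) : ConvergesToInfinity ℓ φ y ρ H := by
  have hb : ∀ t, 0 ≤ t → M < φ t ∧ √(ℓ / 3) ≤ H t ∧ H t ≤ H 0 ∧ 0 ≤ ρ t ∧
      ρ t + 1 / 2 * y t ^ 2 + V (φ t) ≤ ρ 0 + 1 / 2 * y 0 ^ 2 + V (φ 0) := fun t ht =>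
    (h.mono Set.Icc_subset_Ici_self).trapped_bounds ht hV.differentiable hγ.le hk hℓ
      (fun x hx => (hVℓ x hx).1) hρ hH hφ hE
  have hH0 : ∀ t, 0 ≤ t → 0 ≤ H t := fun t ht => (Real.sqrt_nonneg _).trans (hb t ht).2.1
  have hanti := h.energy_antitoneOn hV.differentiable (convex_Ici 0) Set.self_mem_Ici hγ.le hρ hH0
  have hEv : ∀ ε, 0 < ε → ∀ᶠ t in atTop, 0 ≤ t ∧ ρ t + 1 / 2 * y t ^ 2 + V (φ t) < ℓ + ε := by
    intro ε hε
    obtain ⟨r, hr, hrE⟩ := h.exists_energy_lt hV hlim hγ hγ₂ hk hℓ hVℓ (fun t ht => (hb t ht).1)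
      (fun t ht => (hb t ht).2.2.2.1) hH0 (fun t ht => (hb t ht).2.2.1)
      (fun t ht => (hb t ht).2.2.2.2) hε
    filter_upwards [eventually_ge_atTop r] with t ht
    exact ⟨hr.trans ht, (hanti hr (hr.trans ht : (0 : ℝ) ≤ t) ht).trans_lt hrE⟩
  have hVφ : ∀ t, 0 ≤ t → ℓ < V (φ t) := fun t ht => (hVℓ _ (hb t ht).1.le).1
  refine ⟨tendsto_atTop.2 fun B => ?_, Metric.tendsto_nhds.2 fun ε hε => ?_,
    Metric.tendsto_nhds.2 fun ε hε => ?_, Metric.tendsto_nhds.2 fun ε hε => ?_⟩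
  -- As `V` decreases on `[M, ∞)`, an energy below `V(max M B)` forces `φ > B`.
  · have hanti' := (strictAntiOn_Ici_of_deriv_neg hV.differentiable fun x hx => (hVℓ x hx).2)
    have h1 := (hVℓ (max M B) (le_max_left _ _)).1
    filter_upwards [hEv _ (sub_pos.2 h1)] with t ⟨ht, htE⟩
    by_contra! hcon
    have h2 := hanti'.antitoneOn (hb t ht).1.le (le_max_left M B : M ≤ _)
      (hcon.le.trans (le_max_right M B))
    nlinarith [sq_nonneg (y t), (hb t ht).2.2.2.1]
  · filter_upwards [hEv (ε ^ 2 / 2) (by positivity)] with t ⟨ht, htE⟩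
    rw [Real.dist_eq, sub_zero]
    refine abs_lt_of_sq_lt_sq ?_ hε.le
    linarith [hVφ t ht, (hb t ht).2.2.2.1]
  · filter_upwards [hEv ε hε] with t ⟨ht, htE⟩
    rw [Real.dist_eq, sub_zero, abs_of_nonneg (hb t ht).2.2.2.1]
    nlinarith [hVφ t ht, sq_nonneg (y t)]
  · filter_upwards [hEv (ε ^ 2) (by positivity),
      h.curvature_tendsto hγ.le hk hρ hH0 (show 0 < ε ^ 2 / 2 by positivity)] with t ⟨ht, htE⟩ htk
    rw [Real.dist_eq, abs_of_nonneg (sub_nonneg.2 (hb t ht).2.1), sub_lt_iff_lt_add]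
    have h1 := h.friedmann t ht
    have h2 := Real.sq_sqrt (show 0 ≤ ℓ / 3 by positivity)
    refine lt_of_pow_lt_pow_left₀ 2 (by positivity) ?_
    -- By the constraint, `H² < ℓ/3 + ε²/3 + ε²/2 < (ε + √(ℓ/3))²`.
    nlinarith [mul_nonneg hε.le (Real.sqrt_nonneg (ℓ / 3)), pow_pos hε 2]

theorem eventually_nhdsAtInfinity (hlim : Tendsto V atTop (𝓝 ℓ)) (k M : ℝ) {e δ : ℝ} (he : ℓ < e)
    (hδ : 0 < δ) : ∀ᶠ p in nhdsAtInfinity ℓ ⊓ 𝓟 (expandingStates V k),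
      p ∈ expandingStates V k ∧ M < p.1 ∧ p.2.2.1 + 1 / 2 * p.2.1 ^ 2 + V p.1 < e ∧
      p.2.2.2 < √(ℓ / 3) + δ := by
  rw [eventually_inf_principal]
  have h1 : Tendsto (fun p : ℝ × ℝ × ℝ × ℝ => p.1) (nhdsAtInfinity ℓ) atTop := tendsto_fst
  have h4 : Tendsto (fun p : ℝ × ℝ × ℝ × ℝ => p.2.2.2) (nhdsAtInfinity ℓ) (𝓝 √(ℓ / 3)) :=
    tendsto_snd.comp (tendsto_snd.comp tendsto_snd)
  filter_upwards [h1.eventually (eventually_gt_atTop M),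
    (tendsto_energy_nhdsAtInfinity hlim).eventually (gt_mem_nhds he),
    h4.eventually (gt_mem_nhds (lt_add_of_pos_right _ hδ))] with p hp1 hp2 hp3 hp
  exact ⟨hp, hp1, hp2, hp3⟩

theorem isAsymptoticallyStableAtInfinity (hV : IsAdmissiblePotential V) (hγ : 0 < γ) (hγ₂ : γ ≤ 2)
    (hk : k ≤ 0) (hℓ : 0 ≤ ℓ) (hVℓ : Tendsto V atTop (𝓝[>] ℓ)) :
    IsAsymptoticallyStableAtInfinity V γ k ℓ := by
  have hlim := hVℓ.mono_right nhdsWithin_le_nhds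
  obtain ⟨M₀, hM₀⟩ := hV.exists_deriv_neg hVℓ
  constructor
  · intro U hU
    obtain ⟨M₁, δ, hδ, hU⟩ := mem_nhdsAtInfinity_iff.1 hU
    have hM : ∀ x, max M₀ M₁ ≤ x → ℓ < V x := fun x hx => (hM₀ x ((le_max_left _ _).trans hx)).1
    -- The three energy thresholds serve trapping, `ρ < δ`, and `y²/2 < δ²/2` respectively.
    filter_upwards [eventually_nhdsAtInfinity hlim k (max M₀ M₁) (hM _ le_rfl) hδ,
      eventually_nhdsAtInfinity hlim k (max M₀ M₁) (show ℓ < ℓ + δ by linarith) hδ,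
      eventually_nhdsAtInfinity hlim k (max M₀ M₁)
        (show ℓ < ℓ + δ ^ 2 / 2 by linarith [pow_pos hδ 2]) hδ]
      with p ⟨hp, hpM, hpE, hpH⟩ ⟨_, _, hpE₁, _⟩ ⟨_, _, hpE₂, _⟩
    refine ⟨existsGlobally_of_trapped hV hγ hk hℓ hM hp hpM hpE, ?_⟩
    intro a φ y ρ H h hs t ht
    obtain ⟨rfl⟩ := hs
    obtain ⟨h1, h2, h3, h4, h5⟩ := (h.mono Set.Icc_subset_Ici_self).trapped_bounds ht
      hV.differentiable hγ.le hk hℓ hM hp.1 hp.2.1 hpM hpE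
    have h6 := hM _ h1.le
    simp only at hpE₁ hpE₂ hpH
    refine hU _ _ _ _ ((le_max_right _ _).trans_lt h1) (abs_lt_of_sq_lt_sq ?_ hδ.le) ?_ ?_
    · linarith
    · rw [abs_of_nonneg h4]
      nlinarith [sq_nonneg (y t)]
    · rw [abs_of_nonneg (sub_nonneg.2 h2)]
      linarith
  · filter_upwards [eventually_nhdsAtInfinity hlim k M₀ (hM₀ _ le_rfl).1 one_pos]
      with p ⟨hp, hpM, hpE, _⟩
    refine ⟨existsGlobally_of_trapped hV hγ hk hℓ (fun x hx => (hM₀ x hx).1) hp hpM hpE, ?_⟩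
    intro a φ y ρ H h hs
    obtain ⟨rfl⟩ := hs
    exact h.convergesToInfinity hV hlim hγ hγ₂ hk hℓ hM₀ hp.1 hp.2.1 hpM hpE

end Stability

/-! ### Exponential potentials -/

theorem isAdmissiblePotential_exp {V₀ lam : ℝ} (hV₀ : 0 < V₀) (hlam : 0 < lam) :
    IsAdmissiblePotential (fun x => V₀ * Real.exp (-lam * x)) where
  contDiff := by fun_prop
  bounded_neg := by
    convert Bornology.isBounded_empty
    ext x
    simp only [Set.mem_ofPred_eq, Set.mem_empty_iff_false, iff_false, not_lt]
    positivity
  finite_crit := by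
    convert Set.finite_empty
    ext x
    have h : HasDerivAt (fun x => V₀ * Real.exp (-lam * x))
        (V₀ * (Real.exp (-lam * x) * (-lam * 1))) x :=
      (((hasDerivAt_id x).const_mul (-lam)).exp).const_mul V₀
    rw [Set.mem_ofPred_eq, h.deriv]
    simp [hV₀.ne', hlam.ne']

theorem tendsto_exp_nhdsGT {V₀ lam : ℝ} (hV₀ : 0 < V₀) (hlam : 0 < lam) :
    Tendsto (fun x => V₀ * Real.exp (-lam * x)) atTop (𝓝[>] 0) := by
  refine tendsto_nhdsWithin_iff.2 ⟨?_, Eventually.of_forall fun x => by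
    simp only [Set.mem_Ioi]; positivity⟩
  have h := (Real.tendsto_exp_atBot.comp
    (tendsto_id.const_mul_atTop_of_neg (neg_lt_zero.2 hlam))).const_mul V₀
  rwa [mul_zero] at h

/-! ### Instability -/

section Instability

variable {V : ℝ → ℝ} {γ k ℓ : ℝ}

/-- A cosmology whose energy is initially below the limit `ℓ > 0` of the potential does not converge
to the configuration at infinity. -/
theorem IsCosmology.not_convergesToInfinity {a φ y ρ H : ℝ → ℝ}
    (h : IsCosmology V γ k (Set.Ici 0) a φ y ρ H) (hV : Differentiable ℝ V)
    (hlim : Tendsto V atTop (𝓝 ℓ)) (hγ : 0 ≤ γ) (hk : k ≤ 0) (hρ : 0 ≤ ρ 0)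
    (hE : ρ 0 + 1 / 2 * y 0 ^ 2 + V (φ 0) < ℓ) : ¬ ConvergesToInfinity ℓ φ y ρ H := by
  rintro ⟨h1, h2, h3, h4⟩
  have hanti := h.hubble_antitoneOn (convex_Ici 0) Set.self_mem_Ici hγ hk hρ
  -- `H` is decreasing with a nonnegative limit, which supplies the sign needed for energy decay.
  have hH : ∀ t, 0 ≤ t → 0 ≤ H t := fun t ht => by
    refine (Real.sqrt_nonneg (ℓ / 3)).trans (le_of_tendsto h4 ?_)
    filter_upwards [eventually_ge_atTop t] with r hr
    exact hanti ht (ht.trans hr : (0 : ℝ) ≤ r) hr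
  have hlimE := (tendsto_energy_nhdsAtInfinity hlim).comp
    (h1.prodMk (h2.prodMk (h3.prodMk h4)))
  refine hE.not_ge (le_of_tendsto hlimE ?_)
  filter_upwards [eventually_ge_atTop 0] with t ht
  exact h.energy_antitoneOn hV (convex_Ici 0) Set.self_mem_Ici hγ hρ hH Set.self_mem_Ici ht ht

/-- Where `V, V' > 0`, a cosmology cannot stay in the region `φ > M`, `|y| < δ`, `h₀ ≤ H ≤ h₁` for
arbitrarily long times. -/
theorem exists_time_bound {M x h₀ h₁ δ : ℝ} (hV : IsAdmissiblePotential V) (hγ : 0 < γ)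
    (hVM : ∀ z, M ≤ z → 0 < V z ∧ 0 < deriv V z) (hMx : M < x) (hh₀ : 0 < h₀) :
    ∃ T, 0 < T ∧ ∀ a φ y ρ H : ℝ → ℝ, IsCosmology V γ k (Set.Icc 0 T) a φ y ρ H →
      φ 0 = x → y 0 = 0 → ρ 0 = 0 →
      (∀ t ∈ Set.Icc 0 T, M < φ t ∧ |y t| < δ ∧ h₀ ≤ H t ∧ H t ≤ h₁) → False := by
  obtain ⟨c, hc, hcV⟩ : ∃ c, 0 < c ∧ ∀ z, M ≤ z → z ≤ x → c ≤ deriv V z := by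
    obtain ⟨x₀, hx₀, hmin⟩ := isCompact_Icc.exists_isMinOn
      (Set.nonempty_Icc.2 hMx.le) hV.contDiff_deriv.continuous.continuousOn
    exact ⟨deriv V x₀, (hVM x₀ hx₀.1).2, fun z hz hz' => hmin ⟨hz, hz'⟩⟩
  have hVx := (hVM x hMx.le).1
  set A := 9 * h₁ ^ 2 / (2 * c) + |coupling γ| / γ with hA
  have hA0 : 0 ≤ A := by positivity
  set K := A / (3 * h₀) with hK
  have hK0 : 0 ≤ K := by positivity
  have hKh : 3 * K * h₀ = A := by rw [hK]; field_simp
  -- Growing at rate `c/2` from `-K V(x)`, the function `-y - K E` reaches `|δ| + 1` by this time,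
  -- although it is less than `δ`.
  refine ⟨(|δ| + K * V x + 1) / (c / 2), by positivity, fun a φ y ρ H h hφ0 hy0 hρ0 hU => ?_⟩
  set T := (|δ| + K * V x + 1) / (c / 2) with hT
  have hT0 : 0 ≤ T := by positivity
  have h0T : (0 : ℝ) ∈ Set.Icc 0 T := ⟨le_rfl, hT0⟩
  have hTT : T ∈ Set.Icc 0 T := ⟨hT0, le_rfl⟩
  have hρ : ∀ t ∈ Set.Icc 0 T, 0 ≤ ρ t := fun t ht =>
    h.density_nonneg (convex_Icc 0 T) h0T hρ0.ge ht
  have hanti := h.energy_antitoneOn hV.differentiable (convex_Icc 0 T) h0T hγ.le hρ0.ge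
    (fun t ht => hh₀.le.trans (hU t ht).2.2.1)
  -- `V(φ) ≤ E ≤ V(x)` with `V` increasing on `[M, ∞)`, so the slope bound on `[M, x]` applies at
  -- all times.
  have hφx : ∀ t ∈ Set.Icc 0 T, φ t ≤ x := by
    intro t ht
    have h1 := hanti h0T ht ht.1
    simp only [hφ0, hy0, hρ0] at h1
    refine ((strictMonoOn_Ici_of_deriv_pos hV.differentiable fun z hz => (hVM z hz).2).le_iff_le
      (hU t ht).1.le hMx.le).1 ?_
    nlinarith [sq_nonneg (y t), hρ t ht]
  have key := add_mul_le_of_le_derivWithin (δ := c / 2) hT0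
    (fun t ht => (h.motion t ht).neg.sub
      ((h.hasDerivWithinAt_energy hV.differentiable ht).const_mul K)) (fun t ht => by
      obtain ⟨h1, -, h3, h4⟩ := hU t ht
      have hρt := hρ t ht
      have hD : 0 ≤ y t ^ 2 + γ * ρ t := by positivity
      have h5 : |(-3 * H t * y t + coupling γ * ρ t)| ≤ c / 2 + A * (y t ^ 2 + γ * ρ t) :=
        abs_friction_le hγ hc hρt (by
          rw [abs_of_nonneg (hh₀.le.trans h3)]
          exact h4)
      have h6 := le_of_abs_le h5
      have h7 : (3 * K * h₀) * (y t ^ 2 + γ * ρ t) ≤ 3 * K * H t * (y t ^ 2 + γ * ρ t) := by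
        gcongr
      rw [hKh] at h7
      linarith [hcV _ h1.le (hφx t ht)])
  have hcT : c / 2 * T = |δ| + K * V x + 1 := by rw [hT]; field_simp
  obtain ⟨h1, h2, -, -⟩ := hU T hTT
  have h8 : 0 ≤ K * (ρ T + 1 / 2 * y T ^ 2 + V (φ T)) :=
    mul_nonneg hK0 (by nlinarith [hρ T hTT, sq_nonneg (y T), (hVM _ h1.le).1])
  simp only [Pi.sub_apply, Pi.neg_apply, hy0, hρ0, hφ0, hcT] at key
  linarith [neg_abs_le (y T), le_abs_self δ]

theorem isUnstableAtInfinity (hV : IsAdmissiblePotential V) (hγ : 0 < γ)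
    (hk : k = 0 ∨ k = -1) (hVℓ : Tendsto V atTop (𝓝[<] ℓ)) :
    IsUnstableAtInfinity V γ k ℓ := by
  have hlim := hVℓ.mono_right nhdsWithin_le_nhds
  obtain ⟨M₀, hM₀⟩ := hV.exists_deriv_pos hVℓ
  obtain ⟨M₁, hM₁⟩ := hV.bounded_neg.bddAbove
  have hk0 : k ≤ 0 := by rcases hk with rfl | rfl <;> norm_num
  -- The margins give `V(z - 1) ≥ 0` with `z - 1 ≥ M₀`; strict growth over the last unit makes `V(z)
  -- > 0`, and hence `ℓ > 0`.
  set M := max (M₀ + 1) (M₁ + 2) with hM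
  have hVM : ∀ z, M ≤ z → 0 < V z ∧ 0 < deriv V z := by
    intro z hz
    have h1 : M₀ + 1 ≤ z := (le_max_left _ _).trans hz
    have h2 : M₁ + 2 ≤ z := (le_max_right _ _).trans hz
    have h3 : 0 ≤ V (z - 1) := by
      by_contra! hcon
      have : z - 1 ≤ M₁ := hM₁ hcon
      linarith
    refine ⟨h3.trans_lt ?_, (hM₀ z (by linarith)).2⟩
    exact strictMonoOn_Ici_of_deriv_pos hV.differentiable (fun z hz => (hM₀ z hz).2)
      (show M₀ ≤ z - 1 by linarith) (show M₀ ≤ z by linarith) (by linarith)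
  have hVlt : ∀ z, M ≤ z → V z < ℓ := fun z hz =>
    (hM₀ z (by linarith [le_max_left (M₀ + 1) (M₁ + 2)])).1
  have hℓ0 : 0 < ℓ := (hVM M le_rfl).1.trans (hVlt M le_rfl)
  -- Half the limiting value keeps `H` between `δ` and `3δ` inside `U`.
  set δ := √(ℓ / 3) / 2 with hδ
  have hδ0 : 0 < δ := by positivity
  have hδℓ : √(ℓ / 3) = 2 * δ := by rw [hδ]; ring
  set U : Set (ℝ × ℝ × ℝ × ℝ) :=
    {p | M < p.1 ∧ |p.2.1| < δ ∧ |p.2.2.1| < δ ∧ |p.2.2.2 - √(ℓ / 3)| < δ} with hUdef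
  have hU : U ∈ nhdsAtInfinity ℓ := mem_nhdsAtInfinity_iff.2
    ⟨M, δ, hδ0, fun φ y ρ H h1 h2 h3 h4 => ⟨h1, h2, h3, h4⟩⟩
  refine ⟨U, hU, ?_⟩
  -- States at rest without fluid. Taking `a⁻² = (ℓ - V(x))/3` satisfies the constraint, and the
  -- curvature vanishes as `x → ∞`; for `k = -1` this makes `H = √(ℓ/3)` exactly.
  set c : ℝ → ℝ × ℝ × ℝ × ℝ := fun x => (x, 0, 0, √((V x - k * (ℓ - V x)) / 3)) with hc
  have hpos : ∀ x, M ≤ x → 0 < V x - k * (ℓ - V x) := by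
    intro x hx
    nlinarith [(hVM x hx).1, hVlt x hx]
  have hc_mem : ∀ᶠ x in atTop, c x ∈ expandingStates V k := by
    filter_upwards [eventually_ge_atTop M] with x hx
    have h1 := hpos x hx
    have h2 := hVlt x hx
    have h3 : 0 < (ℓ - V x) / 3 := by linarith
    refine ⟨le_rfl, by simp only [hc]; positivity, (√((ℓ - V x) / 3))⁻¹, by positivity, ?_⟩
    simp only [hc]
    rw [Real.sq_sqrt (by positivity), inv_pow, Real.sq_sqrt h3.le, div_inv_eq_mul]
    ring
  have hc_tendsto : Tendsto c atTop (nhdsAtInfinity ℓ) := by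
    refine tendsto_id.prodMk (tendsto_const_nhds.prodMk (tendsto_const_nhds.prodMk ?_))
    have h1 := ((hlim.sub ((hlim.const_sub ℓ).const_mul k)).div_const 3).sqrt
    rwa [sub_self, mul_zero, sub_zero] at h1
  have hc_tendsto' : Tendsto c atTop (nhdsAtInfinity ℓ ⊓ 𝓟 (expandingStates V k)) :=
    tendsto_inf.2 ⟨hc_tendsto, tendsto_principal.2 hc_mem⟩
  refine hc_tendsto'.frequently (Eventually.frequently ?_)
  filter_upwards [hc_mem, hc_tendsto.eventually hU, eventually_gt_atTop M] with x hx hxU hMx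
  refine ⟨?_, fun a φ y ρ H h hs => ?_⟩
  · obtain ⟨T, hT, hbound⟩ := exists_time_bound (k := k) (h₀ := δ) (h₁ := 3 * δ) (δ := δ) hV hγ hVM
      hMx hδ0
    obtain ⟨-, -, a₀, ha₀, hF⟩ := hx
    -- `R` exceeds both the initial norm and the a priori bound on `[0, T]` for a solution in `U`,
    -- so a solution staying in `U` lasts until `T`.
    set R := ‖(Real.log a₀, c x)‖ + (|Real.log a₀| + |x| + 3 * δ * T + 3 * δ + 1) with hR
    have hRpos : 0 < |Real.log a₀| + |x| + 3 * δ * T + 3 * δ + 1 := by positivity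
    obtain ⟨S, a, φ, y, ρ, H, hS, hST, h, hs, ha, hexit⟩ :=
      exists_isCosmology_until_exit γ hV ha₀ hF (R := R) (T := T) (by linarith) hT
    by_contra! hcon
    have hstay : ∀ t ∈ Set.Icc 0 S, (φ t, y t, ρ t, H t) ∈ U := by
      intro t ht
      rcases ht.1.eq_or_lt with h0 | h0
      · rw [← h0, show (φ 0, y 0, ρ 0, H 0) = c x from hs]
        exact hxU
      · by_contra hout
        exact hout (hcon t h0 a φ y ρ H (h.mono (Set.Icc_subset_Icc_right ht.2)) hs)
    have hH : ∀ t ∈ Set.Icc 0 S, δ ≤ H t ∧ H t ≤ 3 * δ := by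
      intro t ht
      have h1 := abs_lt.1 (hstay t ht).2.2.2
      simp only [hδℓ] at h1
      constructor <;> linarith
    simp only [StartsAt, hc, Prod.mk.injEq] at hs
    have hnorm := h.norm_le (C := 3 * δ) hS.le
      (fun t ht => by linarith [(hstay t ht).2.1])
      (by linarith [(hstay S ⟨hS.le, le_rfl⟩).2.2.1])
      (fun t ht => by
        rw [abs_of_nonneg (hδ0.le.trans (hH t ht).1)]
        exact (hH t ht).2)
    rw [ha, hs.1] at hnorm
    have h1 : 3 * δ * S ≤ 3 * δ * T := by gcongr
    rcases hexit with rfl | hexit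
    · exact hbound a φ y ρ H h hs.1 hs.2.1 hs.2.2.1 (fun t ht =>
        ⟨(hstay t ht).1, (hstay t ht).2.1, (hH t ht).1, (hH t ht).2⟩)
    · rw [hexit] at hnorm
      linarith [norm_nonneg (Real.log a₀, c x)]
  · simp only [StartsAt, hc, Prod.mk.injEq] at hs
    refine h.not_convergesToInfinity hV.differentiable hlim hγ.le hk0 hs.2.2.1.ge ?_
    rw [hs.1, hs.2.1, hs.2.2.1]
    linarith [hVlt x hMx.le]

end Instability

theorem mainTheorem3 (γ : ℝ) (hγ₀ : 0 < γ) (hγ₂ : γ ≤ 2) (k : ℝ) (hk : k = 0 ∨ k = -1) :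
    (∀ (V : ℝ → ℝ) (ℓ : ℝ), IsAdmissiblePotential V → 0 ≤ ℓ → Tendsto V atTop (𝓝[>] ℓ) →
      IsAsymptoticallyStableAtInfinity V γ k ℓ) ∧
    (∀ V₀ lam : ℝ, 0 < V₀ → 0 < lam →
      IsAsymptoticallyStableAtInfinity (fun x => V₀ * Real.exp (-lam * x)) γ k 0) ∧
    (∀ (V : ℝ → ℝ) (ℓ : ℝ), IsAdmissiblePotential V → 0 ≤ ℓ → Tendsto V atTop (𝓝[<] ℓ) →
      IsUnstableAtInfinity V γ k ℓ) := by
  have hk0 : k ≤ 0 := by rcases hk with rfl | rfl <;> norm_num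
  exact ⟨fun V ℓ hV hℓ hVℓ => isAsymptoticallyStableAtInfinity hV hγ₀ hγ₂ hk0 hℓ hVℓ,
    fun V₀ lam hV₀ hlam => isAsymptoticallyStableAtInfinity (isAdmissiblePotential_exp hV₀ hlam)
      hγ₀ hγ₂ hk0 le_rfl (tendsto_exp_nhdsGT hV₀ hlam),
    fun V ℓ hV _ hVℓ => isUnstableAtInfinity hV hγ₀ hk hVℓ⟩
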